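/- **Setting.** Let $L\ge 2$, let $P_1,\dots,P_L$ be probability distributions on an arbitrary measurable space, let $\Pi=(\pi_{i,j})$ be an $M\times L$ matrix with nonnegative entries and rows summing to $1$, and put $\tilde P_i=\sum_{j}\pi_{i,j}P_j$ ($1\le i\le M$), $P=(P_1,\dots,P_L)^T$, $\tilde P=(\tilde P_1,\dots,\tilde P_M)^T$. Linear combinations of distributions are taken in the vector space of finite signed measures. The *partial label matrix* is $S=(\mathbf 1\{\pi_{i,j}>0\})_{i,j}$. The distributions $P_1,\dots,P_L$ are *jointly irreducible* if, whenever $\sum_i\gamma_iP_i$ with $\gamma\in\mathbb R^L$ is a probability distribution, $\gamma_i\ge 0$ for all $i$. For distributions $F_0,F_1$ let $\kappa^*(F_0\,|\,F_1)=\max\{\kappa\in[0,1] : F_0=(1-\kappa)G+\kappa F_1\text{ for some distribution }G\}$. For distributions $F_0,\dots,F_K$ let $$\kappa^*(F_0\,|\,F_1,\dots,F_K)=\max\Big\{\sum_{i=1}^K\nu_i : \nu_i\ge 0,\ \sum_i\nu_i\le 1,\ F_0=\Big(1-\sum_i\nu_i\Big)G+\sum_i\nu_iF_i\text{ for some distribution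 }G\Big\}.$$ The call $\mathrm{sol}(F_0\,|\,\{F_1,\dots,F_K\})$ picks any $\nu$ achieving this maximum and returns $\big(F_0-\sum_i\nu_iF_i\big)/\big(1-\sum_i\nu_i\big)$; it is undefined if $\sum_i\nu_i=1$. $\mathrm{VertexTest}(S,\tilde P,(W_1,\dots,W_L))$: if $\kappa^*(W_i\,|\,W_j)>0$ for some $i\ne j$, return $(0,0)$. Otherwise form $Z_{i,j}=\mathbf 1\{\kappa^*(\tilde P_i\,|\,W_j)>0\}$; if there is a permutation matrix $C$ with $ZC=S$, return $(1,C^T)$ for any such $C$, else return $(0,0)$. $\mathrm{PartialLabel}(S,\tilde P)$: 1. Draw $Q_1,\dots,Q_L$ independently and uniformly (with respect to normalized Lebesgue measure in affine coordinates) from the convex hull $\mathrm{co}(\tilde P_1,\dots,\tilde P_M)$; set $W_i\leftarrow Q_i$ for all $i$, and $k\leftarrow 2$. 2. For $i=1,\dots,L$ in turn: set $\bar Q_i\leftarrow\frac1{L-1}\big(\sum_{j>i}Q_j+\sum_{j<i}W_j\big)$ and then $W_i\leftarrow\mathrm{sol}\big(\tfrac1kQ_i+(1-\tfrac1k)\bar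 Q_i\,\big|\,\{Q_j\}_{j>i}\cup\{W_j\}_{j<i}\big)$. 3. Compute $(T,C)\leftarrow\mathrm{VertexTest}(S,\tilde P,(W_1,\dots,W_L))$ and set $k\leftarrow k+1$. If $T=0$, go to step 2; if $T=1$, return $C\,(W_1,\dots,W_L)^T$. **Theorem.** Suppose that $P_1,\dots,P_L$ are jointly irreducible, $\Pi$ has full column rank, and the columns of $S$ are pairwise distinct. Then, with probability $1$ over the draw of $Q_1,\dots,Q_L$, whatever choices are made inside $\mathrm{sol}$ and $\mathrm{VertexTest}$, every step of $\mathrm{PartialLabel}(S,\tilde P)$ is well defined, the algorithm terminates, and it returns $R=(R_1,\dots,R_L)^T$ with $R_i=P_i$ for every $i$. -/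

import Mathlib

open MeasureTheory ProbabilityTheory

namespace PartialLabels

noncomputable section

/-! ### Distributions as elements of the vector space of signed measures -/

/-- A probability distribution, viewed in the real vector space of signed measures. -/
def toSM {X : Type*} [MeasurableSpace X] (μ : ProbabilityMeasure X) : SignedMeasure X :=
  (μ : Measure X).toSignedMeasure

/-- The signed measure `s` is a (probability) distribution. -/
def IsDistribution {X : Type*} [MeasurableSpace X] (s : SignedMeasure X) : Prop :=
  ∃ μ : ProbabilityMeasure X, s = toSM μ

/-- Joint irreducibility: a linear combination of the `P i` that is a distribution has nonnegative
coefficients. -/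
def JointlyIrreducible {X : Type*} [MeasurableSpace X] {L : ℕ}
    (P : Fin L → ProbabilityMeasure X) : Prop :=
  ∀ γ : Fin L → ℝ, IsDistribution (∑ i, γ i • toSM (P i)) → ∀ i, 0 ≤ γ i

/-- The contaminated distributions: the `i`-th one is `∑ j, mixing i j • P j`. -/
def contaminated {X : Type*} [MeasurableSpace X] {L M : ℕ}
    (mixing : Matrix (Fin M) (Fin L) ℝ) (P : Fin L → ProbabilityMeasure X) :
    Fin M → SignedMeasure X :=
  fun i => ∑ j, mixing i j • toSM (P j)

/-- The partial label matrix `(1{mixing i j > 0})`. -/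
def partialLabelMatrix {L M : ℕ} (mixing : Matrix (Fin M) (Fin L) ℝ) :
    Matrix (Fin M) (Fin L) ℝ :=
  Matrix.of fun i j => if 0 < mixing i j then 1 else 0

/-! ### The operators `κ*` and the solutions of the multi-sample problem -/

/-- The two-sample operator: the largest `κ ∈ [0, 1]` such that `F₀ = (1 - κ) G + κ F₁` for some
distribution `G`. -/
def kappaStar {X : Type*} [MeasurableSpace X] (F₀ F₁ : SignedMeasure X) : ℝ :=
  sSup {κ : ℝ | 0 ≤ κ ∧ κ ≤ 1 ∧
    ∃ G : SignedMeasure X, IsDistribution G ∧ F₀ = (1 - κ) • G + κ • F₁}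

/-- `ν` is feasible for the maximum that defines the multi-sample `κ*(F₀ | (F i)_i)`. -/
def Feasible {X : Type*} [MeasurableSpace X] {ι : Type*} [Fintype ι]
    (F₀ : SignedMeasure X) (F : ι → SignedMeasure X) (ν : ι → ℝ) : Prop :=
  (∀ i, 0 ≤ ν i) ∧ ∑ i, ν i ≤ 1 ∧
    ∃ G : SignedMeasure X, IsDistribution G ∧
      F₀ = (1 - ∑ i, ν i) • G + ∑ i, ν i • F i

/-- `ν` achieves the maximum in the multi-sample `κ*(F₀ | (F i)_i)`. -/
def AttainsKappaStar {X : Type*} [MeasurableSpace X] {ι : Type*} [Fintype ι]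
    (F₀ : SignedMeasure X) (F : ι → SignedMeasure X) (ν : ι → ℝ) : Prop :=
  Feasible F₀ F ν ∧ ∀ ν' : ι → ℝ, Feasible F₀ F ν' → ∑ i, ν' i ≤ ∑ i, ν i

/-- `G` is a possible output of the call `sol(F₀ | (F i)_i)`: some `ν` achieving the maximum is
chosen and `(F₀ - ∑ i, ν i • F i) / (1 - ∑ i, ν i)` is returned. The call has no output along a
choice for which the division is by zero. -/
def IsSol {X : Type*} [MeasurableSpace X] {ι : Type*} [Fintype ι]
    (F₀ : SignedMeasure X) (F : ι → SignedMeasure X) (G : SignedMeasure X) : Prop :=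
  ∃ ν : ι → ℝ, AttainsKappaStar F₀ F ν ∧ 1 - ∑ i, ν i ≠ 0 ∧
    G = (1 - ∑ i, ν i)⁻¹ • (F₀ - ∑ i, ν i • F i)

/-! ### VertexTest -/

/-- The matrix `(1{κ*(F i | G j) > 0})`. -/
def kappaPattern {X : Type*} [MeasurableSpace X] {m n : ℕ}
    (F : Fin m → SignedMeasure X) (G : Fin n → SignedMeasure X) : Matrix (Fin m) (Fin n) ℝ :=
  Matrix.of fun i j => if 0 < kappaStar (F i) (G j) then 1 else 0

/-- `C` is a permutation matrix. -/
def IsPermMatrix {L : ℕ} (C : Matrix (Fin L) (Fin L) ℝ) : Prop :=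
  ∃ σ : Equiv.Perm (Fin L), C = σ.permMatrix ℝ

/-- `VertexTest S Pt W out`: the pair `out` is a possible output of VertexTest on the partial label
matrix `S`, the contaminated distributions `Pt` and the candidates `W`. Any permutation matrix `C`
with `Z * C = S` may be the one that is found. -/
inductive VertexTest {X : Type*} [MeasurableSpace X] {L M : ℕ}
    (S : Matrix (Fin M) (Fin L) ℝ) (Pt : Fin M → SignedMeasure X) (W : Fin L → SignedMeasure X) :
    ℕ × Matrix (Fin L) (Fin L) ℝ → Prop
  | offDiagonal : (∃ i j, i ≠ j ∧ kappaPattern W W i j ≠ 0) → VertexTest S Pt W (0, 0)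
  | found (C : Matrix (Fin L) (Fin L) ℝ) :
      (∀ i j, i ≠ j → kappaPattern W W i j = 0) →
      IsPermMatrix C → kappaPattern Pt W * C = S → VertexTest S Pt W (1, C.transpose)
  | notFound :
      (∀ i j, i ≠ j → kappaPattern W W i j = 0) →
      (¬ ∃ C : Matrix (Fin L) (Fin L) ℝ, IsPermMatrix C ∧ kappaPattern Pt W * C = S) →
      VertexTest S Pt W (0, 0)

/-! ### PartialLabel -/

/-- `(1 / (L - 1)) (∑_{j > i} Q j + ∑_{j < i} W j)`. -/
def average {X : Type*} [MeasurableSpace X] {L : ℕ} (Q W : Fin L → SignedMeasure X) (i : Fin L) :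
    SignedMeasure X :=
  (1 / ((L : ℝ) - 1)) • (∑ j ∈ Finset.Ioi i, Q j + ∑ j ∈ Finset.Iio i, W j)

/-- The family consisting of the `Q j` with `j > i` and the `W j` with `j < i`. -/
def others {X : Type*} [MeasurableSpace X] {L : ℕ} (Q W : Fin L → SignedMeasure X) (i : Fin L) :
    {j : Fin L // j ≠ i} → SignedMeasure X :=
  fun j => if i < j then Q j else W j

/-- Configurations of PartialLabel after the random draw of `Q`. -/
inductive State (X : Type*) [MeasurableSpace X] (L : ℕ)
  /-- In the pass of the while loop with counter `k`, the inner loop (indices `0, …, L - 1`) is about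
  to treat index `i`; if `i = L`, the inner loop is complete and VertexTest comes next. -/
  | run (k i : ℕ) (W : Fin L → SignedMeasure X)
  /-- The algorithm has returned `R`. -/
  | halt (R : Fin L → SignedMeasure X)

/-- One step of PartialLabel. Both `sol` and VertexTest may make any choice they are allowed. -/
inductive Step {X : Type*} [MeasurableSpace X] {L M : ℕ}
    (S : Matrix (Fin M) (Fin L) ℝ) (Pt : Fin M → SignedMeasure X) (Q : Fin L → SignedMeasure X) :
    State X L → State X L → Prop
  | solve (k i : ℕ) (W : Fin L → SignedMeasure X) (h : i < L) (G : SignedMeasure X) :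
      IsSol ((1 / (k : ℝ)) • Q ⟨i, h⟩ + (1 - 1 / (k : ℝ)) • average Q W ⟨i, h⟩)
        (others Q W ⟨i, h⟩) G →
      Step S Pt Q (.run k i W) (.run k (i + 1) (Function.update W ⟨i, h⟩ G))
  | retry (k : ℕ) (W : Fin L → SignedMeasure X) (C : Matrix (Fin L) (Fin L) ℝ) :
      VertexTest S Pt W (0, C) → Step S Pt Q (.run k L W) (.run (k + 1) 0 W)
  | accept (k : ℕ) (W : Fin L → SignedMeasure X) (C : Matrix (Fin L) (Fin L) ℝ) :
      VertexTest S Pt W (1, C) →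
      Step S Pt Q (.run k L W) (.halt fun i => ∑ j, C i j • W j)

/-- PartialLabel with draws `Q` returns `R`: whatever choices are made in its subroutines, it does
not run forever, and when no further step is possible it has returned `R` (so that, in particular,
no call of a subroutine is ever undefined). -/
def PartialLabelReturns {X : Type*} [MeasurableSpace X] {L M : ℕ}
    (S : Matrix (Fin M) (Fin L) ℝ) (Pt : Fin M → SignedMeasure X) (Q : Fin L → SignedMeasure X)
    (R : Fin L → SignedMeasure X) : Prop :=
  (¬ ∃ s : ℕ → State X L, s 0 = .run 2 0 Q ∧ ∀ n, Step S Pt Q (s n) (s (n + 1))) ∧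
  ∀ s : State X L, Relation.ReflTransGen (Step S Pt Q) (.run 2 0 Q) s →
    (∀ t, ¬ Step S Pt Q s t) → s = .halt R

/-! ### Random draws -/

/-- The random elements `Q i` of the real vector space `E` are independent and each is uniformly
distributed on `K`, a set of finite affine dimension: in some (equivalently, in any) affine
coordinate system of the affine span of `K`, the coordinate vectors are independent and have the
normalized Lebesgue measure on `K` as their law. -/
def IndepUniformOn {Ω : Type*} [MeasurableSpace Ω] (Pr : Measure Ω)
    {E : Type*} [AddCommGroup E] [Module ℝ E] {L : ℕ} (K : Set E) (Q : Fin L → Ω → E) : Prop :=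
  ∃ (d : ℕ) (φ : (Fin d → ℝ) →ᵃ[ℝ] E) (U : Fin L → Ω → Fin d → ℝ),
    Function.Injective φ ∧ Set.range φ = (affineSpan ℝ K : Set E) ∧
    (∀ i, Measurable (U i)) ∧ iIndepFun U Pr ∧
    (∀ i, pdf.IsUniform (U i) (φ ⁻¹' K) Pr volume) ∧
    ∀ i, ∀ᵐ ω ∂Pr, Q i ω = φ (U i ω)

end

end PartialLabels

/-!
In the coordinates of `P 1, …, P L` the problem becomes a geometric one. Joint irreducibility makes
the base distributions linearly independent and says that a point of their span is a distribution
exactly when its coordinates lie in the standard simplex (`JointlyIrreducible.mix_injective`,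
`JointlyIrreducible.isDistribution_mix_iff`). So `sol` and `κ*` speak about the simplex only, and
`κ*(a | b) > 0` means that the support of `b` is contained in that of `a`.

*A call of `sol`.* Let `m i = Q i` and let `m j`, `j ≠ i`, be the other members of the family. If
they are linearly independent, let `h` be the linear functional with `h (m i) = 1` that vanishes on
the other `m j`. The argument of `sol` has height `1 / k`, and a residue `g` with weights `ν`
satisfies `(1 - ∑ j, ν j) * h g = 1 / k`. Thus maximizing `∑ j, ν j` means maximizing the height of
`g`. Every residue has positive height, so replacing `m i` by it preserves linear independence; this
is why no call is ever undefined. For large `k` the weights are automatically nonnegative when `g`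
is the highest vertex of the simplex, so `sol` must return that vertex, provided it is unique
(`IsSol.eventually_eq_vertex`).

*General position.* Uniqueness can fail only if an edge of the simplex is parallel to the hyperplane
`ker h`. As the draws have laws that charge no proper affine subspace, this happens with probability
zero, whichever vertices were found before (`ae_inGeneralPosition`). There are finitely many such
configurations, so one threshold on `k` works for all of them. Past the threshold the family
consists of distinct vertices at the end of the inner loop, and VertexTest accepts.

*VertexTest.* Conversely, whenever VertexTest accepts points of the simplex, even before the
threshold, they are the vertices in the right order. This is a statement about the supports, which
form an antichain and have prescribed inclusions into the supports of the rows of the mixing matrix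
(`eq_of_mem_of_antichain`); it uses that the columns of the partial label matrix are distinct.
-/

namespace PartialLabels

/-! ### Coordinates on the span of the base distributions -/

section Coordinates

variable {X : Type*} [MeasurableSpace X] {L : ℕ}

/-- The signed measure `∑ i, c i • P i` with coordinates `c`. -/
noncomputable def mix (P : Fin L → ProbabilityMeasure X) : (Fin L → ℝ) →ₗ[ℝ] SignedMeasure X :=
  Fintype.linearCombination ℝ fun i => toSM (P i)

theorem mix_apply (P : Fin L → ProbabilityMeasure X) (c : Fin L → ℝ) :
    mix P c = ∑ i, c i • toSM (P i) := rfl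

theorem mix_single (P : Fin L → ProbabilityMeasure X) (i : Fin L) :
    mix P (Pi.single i 1) = toSM (P i) := by
  simp [mix, Fintype.linearCombination_apply_single]

theorem toSM_univ (μ : ProbabilityMeasure X) : toSM μ Set.univ = 1 := by
  simp [toSM, Measure.toSignedMeasure_apply_measurable MeasurableSet.univ]

theorem IsDistribution.univ {s : SignedMeasure X} (h : IsDistribution s) : s Set.univ = 1 := by
  obtain ⟨μ, rfl⟩ := h
  exact toSM_univ μ

theorem mix_univ (P : Fin L → ProbabilityMeasure X) (c : Fin L → ℝ) :
    mix P c Set.univ = ∑ i, c i := by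
  simp [mix_apply, toSM_univ]

theorem isDistribution_mix (P : Fin L → ProbabilityMeasure X) {c : Fin L → ℝ}
    (hc : c ∈ stdSimplex ℝ (Fin L)) : IsDistribution (mix P c) := by
  have hprob : IsProbabilityMeasure (∑ i, ENNReal.ofReal (c i) • (P i : Measure X)) := by
    constructor
    simp [← ENNReal.ofReal_sum_of_nonneg fun i _ => hc.1 i, hc.2]
  refine ⟨⟨_, hprob⟩, ?_⟩
  ext s hs
  simp only [mix_apply, toSM, FunLike.coe_sum, Finset.sum_apply,
    FunLike.coe_smul, Pi.smul_apply, Measure.toSignedMeasure_apply_measurable hs,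
    ProbabilityMeasure.coe_mk, smul_eq_mul, measureReal_def, Measure.coe_finsetSum,
    Measure.smul_apply]
  rw [ENNReal.toReal_sum fun i _ => ENNReal.mul_ne_top ENNReal.ofReal_ne_top (measure_ne_top _ _)]
  exact Finset.sum_congr rfl fun i _ => by
    rw [ENNReal.toReal_mul, ENNReal.toReal_ofReal (hc.1 i)]

theorem JointlyIrreducible.isDistribution_mix_iff {P : Fin L → ProbabilityMeasure X}
    (hP : JointlyIrreducible P) (c : Fin L → ℝ) :
    IsDistribution (mix P c) ↔ c ∈ stdSimplex ℝ (Fin L) :=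
  ⟨fun h => ⟨hP c h, by rw [← mix_univ P c, h.univ]⟩, isDistribution_mix P⟩

/-- Jointly irreducible distributions are linearly independent: a linear relation could be added
to some `P i` to give it a negative coefficient. -/
theorem JointlyIrreducible.mix_injective {P : Fin L → ProbabilityMeasure X}
    (hP : JointlyIrreducible P) : Function.Injective (mix P) := by
  refine (injective_iff_map_eq_zero _).2 fun c hc => ?_
  by_contra hne
  obtain ⟨i, hi⟩ := Function.ne_iff.1 hne
  have h := hP (Pi.single i 1 - (2 / c i) • c) (by
    change IsDistribution (mix P _)
    rw [map_sub, map_smul, hc, smul_zero, sub_zero, mix_single]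
    exact ⟨_, rfl⟩) i
  have hi' : c i ≠ 0 := hi
  simp [hi'] at h

theorem eq_single_of_mem_stdSimplex {g : Fin L → ℝ} (hg : g ∈ stdSimplex ℝ (Fin L)) {l : Fin L}
    (h0 : ∀ a, a ≠ l → g a = 0) : g = Pi.single l 1 := by
  have h1 : g l = 1 := by rw [← hg.2, Finset.sum_eq_single l (fun b _ hb => h0 b hb) (by simp)]
  ext a
  rcases eq_or_ne a l with rfl | ha
  · rw [h1, Pi.single_eq_same]
  · rw [h0 a ha, Pi.single_eq_of_ne ha]

end Coordinates

/-! ### The operators `κ*` and `sol` in coordinates -/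

section Operators

variable {X : Type*} [MeasurableSpace X] {L : ℕ}

theorem JointlyIrreducible.feasible_mix_iff {P : Fin L → ProbabilityMeasure X}
    (hP : JointlyIrreducible P) {ι : Type*} [Fintype ι] {c : Fin L → ℝ}
    (hc : c ∈ stdSimplex ℝ (Fin L)) (f : ι → Fin L → ℝ) (ν : ι → ℝ) :
    Feasible (mix P c) (fun j => mix P (f j)) ν ↔ (∀ j, 0 ≤ ν j) ∧ ∑ j, ν j ≤ 1 ∧
      ∃ g ∈ stdSimplex ℝ (Fin L), c = (1 - ∑ j, ν j) • g + ∑ j, ν j • f j := by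
  refine and_congr_right fun _ => and_congr_right fun _ => ⟨?_, ?_⟩
  · rintro ⟨G, hG, h⟩
    by_cases h1 : 1 - ∑ j, ν j = 0
    · -- the residue has coefficient zero, so any point of the simplex will do
      refine ⟨c, hc, hP.mix_injective ?_⟩
      simp only [map_add, map_smul, map_sum]
      rw [h1, zero_smul] at h ⊢
      exact h
    · have hG' : G = mix P ((1 - ∑ j, ν j)⁻¹ • (c - ∑ j, ν j • f j)) := by
        simp only [map_sub, map_smul, map_sum]
        rw [h, add_sub_cancel_right, smul_smul, inv_mul_cancel₀ h1, one_smul]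
      refine ⟨_, (hP.isDistribution_mix_iff _).1 (hG' ▸ hG), ?_⟩
      rw [smul_smul, mul_inv_cancel₀ h1, one_smul, sub_add_cancel]
  · rintro ⟨g, hg, h⟩
    refine ⟨mix P g, isDistribution_mix P hg, ?_⟩
    conv_lhs => rw [h]
    simp only [map_add, map_smul, map_sum]

/-- The maximum in the multi-sample `κ*` is attained, by compactness of the simplex. -/
theorem JointlyIrreducible.exists_attainsKappaStar {P : Fin L → ProbabilityMeasure X}
    (hP : JointlyIrreducible P) {ι : Type*} [Fintype ι] {c : Fin L → ℝ}
    (hc : c ∈ stdSimplex ℝ (Fin L)) (f : ι → Fin L → ℝ) :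
    ∃ ν, AttainsKappaStar (mix P c) (fun j => mix P (f j)) ν := by
  have hK : IsCompact ((Set.Icc (0 : ι → ℝ) 1 ×ˢ stdSimplex ℝ (Fin L)) ∩
      {p | ∑ j, p.1 j ≤ 1 ∧ c = (1 - ∑ j, p.1 j) • p.2 + ∑ j, p.1 j • f j}) := by
    refine (isCompact_Icc.prod (isCompact_stdSimplex ℝ (Fin L))).inter_right ?_
    refine IsClosed.inter (s₁ := {p : (ι → ℝ) × (Fin L → ℝ) | ∑ j, p.1 j ≤ 1})
      (isClosed_le (by fun_prop) (by fun_prop)) (isClosed_eq (by fun_prop) (by fun_prop))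
  obtain ⟨⟨ν, g⟩, ⟨⟨hν, hg⟩, hν1, heq⟩, hmax⟩ := hK.exists_isMaxOn
    (f := fun p : (ι → ℝ) × (Fin L → ℝ) => ∑ j, p.1 j)
    ⟨(0, c), ⟨⟨by simp, hc⟩, by simp, by simp⟩⟩ (by fun_prop)
  refine ⟨ν, (hP.feasible_mix_iff hc f ν).2 ⟨hν.1, hν1, g, hg, heq⟩, fun ν' hν' => ?_⟩
  obtain ⟨h0, h1, g', hg', heq'⟩ := (hP.feasible_mix_iff hc f ν').1 hν'
  refine hmax (a := (ν', g')) ⟨⟨⟨h0, fun j => ?_⟩, hg'⟩, h1, heq'⟩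
  exact (Finset.single_le_sum (fun j _ => h0 j) (Finset.mem_univ j)).trans h1

/-- `κ*(a | b)` is positive exactly when the support of `b` is contained in that of `a`. -/
theorem JointlyIrreducible.kappaStar_pos_iff {P : Fin L → ProbabilityMeasure X}
    (hP : JointlyIrreducible P) {a b : Fin L → ℝ}
    (ha : a ∈ stdSimplex ℝ (Fin L)) (hb : b ∈ stdSimplex ℝ (Fin L)) :
    0 < kappaStar (mix P a) (mix P b) ↔ ∀ i, 0 < b i → 0 < a i := by
  have key : 0 < kappaStar (mix P a) (mix P b) ↔ ∃ κ : ℝ, 0 < κ ∧ κ ≤ 1 ∧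
      ∃ G : SignedMeasure X, IsDistribution G ∧ mix P a = (1 - κ) • G + κ • mix P b := by
    constructor
    · intro h
      by_contra! hcon
      refine h.not_ge (Real.sSup_le ?_ le_rfl)
      rintro κ ⟨-, h1, G, hG, heq⟩
      by_contra! hκ
      exact hcon κ hκ h1 G hG heq
    · rintro ⟨κ, h0, h1, hG⟩
      exact h0.trans_le (le_csSup ⟨1, fun x hx => hx.2.1⟩ ⟨h0.le, h1, hG⟩)
  rw [key]
  constructor
  · rintro ⟨κ, h0, h1, hG⟩ i hi
    have hF := (hP.feasible_mix_iff ha (fun _ : Unit => b) fun _ => κ).1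
      ⟨fun _ => h0.le, by simpa using h1, by simpa using hG⟩
    obtain ⟨-, -, g, hg, heq⟩ := hF
    have hai := congrFun heq i
    simp only [Finset.univ_unique, Finset.sum_const, Finset.card_singleton, one_smul,
      Pi.add_apply, Pi.smul_apply, smul_eq_mul] at hai
    rw [hai]
    have := mul_nonneg (sub_nonneg.2 h1) (hg.1 i)
    have := mul_pos h0 hi
    linarith
  · intro h
    -- a small multiple of `b` can be subtracted from `a`
    have hev : ∀ᶠ κ : ℝ in nhdsWithin 0 (Set.Ioi 0), ∀ i, κ * b i ≤ a i := by
      refine Filter.eventually_all.2 fun i => ?_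
      rcases (hb.1 i).eq_or_lt with hbi | hbi
      · exact .of_forall fun κ => by rw [← hbi, mul_zero]; exact ha.1 i
      · have ht : Filter.Tendsto (fun κ : ℝ => κ * b i) (nhdsWithin 0 (Set.Ioi 0)) (nhds 0) := by
          have : ContinuousAt (fun κ : ℝ => κ * b i) 0 := by fun_prop
          simpa using this.tendsto.mono_left nhdsWithin_le_nhds
        exact (ht.eventually_lt_const (h i hbi)).mono fun κ hκ => hκ.le
    obtain ⟨κ, hκ, hκ0, hκ1⟩ :=
      (hev.and (Ioo_mem_nhdsGT (zero_lt_one' ℝ))).exists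
    have hpos : 0 < 1 - κ := sub_pos.2 hκ1
    refine ⟨κ, hκ0, hκ1.le, mix P ((1 - κ)⁻¹ • (a - κ • b)),
      isDistribution_mix P ⟨fun i => ?_, ?_⟩, ?_⟩
    · exact mul_nonneg (inv_nonneg.2 hpos.le) (sub_nonneg.2 (hκ i))
    · simp only [Pi.smul_apply, Pi.sub_apply, smul_eq_mul, ← Finset.mul_sum,
        Finset.sum_sub_distrib, ha.2, hb.2, mul_one]
      exact inv_mul_cancel₀ hpos.ne'
    · rw [map_smul, smul_smul, mul_inv_cancel₀ hpos.ne', one_smul, map_sub, map_smul,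
        sub_add_cancel]

end Operators

/-! ### VertexTest in coordinates -/

section VertexTest

variable {X : Type*} [MeasurableSpace X] {L M : ℕ} {P : Fin L → ProbabilityMeasure X}

theorem contaminated_eq_mix (mixing : Matrix (Fin M) (Fin L) ℝ) (P : Fin L → ProbabilityMeasure X)
    (i : Fin M) : contaminated mixing P i = mix P (mixing i) := rfl

theorem kappaPattern_mix_ne_zero_iff (hP : JointlyIrreducible P) {m n : ℕ}
    {a : Fin m → Fin L → ℝ} {b : Fin n → Fin L → ℝ} (ha : ∀ i, a i ∈ stdSimplex ℝ (Fin L))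
    (hb : ∀ i, b i ∈ stdSimplex ℝ (Fin L)) (i : Fin m) (j : Fin n) :
    kappaPattern (fun i => mix P (a i)) (fun j => mix P (b j)) i j ≠ 0 ↔
      ∀ l, 0 < b j l → 0 < a i l := by
  rw [← hP.kappaStar_pos_iff (ha i) (hb j)]
  simp [kappaPattern]

theorem mul_permMatrix_apply {m n : ℕ} (Z : Matrix (Fin m) (Fin n) ℝ) (σ : Equiv.Perm (Fin n))
    (i : Fin m) (j : Fin n) : (Z * σ.permMatrix ℝ) i j = Z i (σ.symm j) := by
  rw [Matrix.mul_apply, Finset.sum_eq_single (σ.symm j)]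
  · simp [Equiv.Perm.permMatrix, PEquiv.toMatrix_apply]
  · intro k _ hk
    have hk' : σ k ≠ j := fun h => hk (by rw [← h, σ.symm_apply_apply])
    simp [Equiv.Perm.permMatrix, PEquiv.toMatrix_apply, hk']
  · simp

/-- The combinatorial core of VertexTest. Suppose that the sets `D j` form an antichain and that
`D j ⊆ A i` exactly when `j ∈ A i`. If points are separated by the sets `A i`, then `D j` has no
other element than `j`: passing from `j` to `l ∈ D j` with `l ≠ j` strictly enlarges the set of all
`i` with `j ∈ A i`, so by induction `D l ⊆ {l} ⊆ D j`, against the antichain property. -/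
theorem eq_of_mem_of_antichain {ι κ : Type*} [Finite ι] {A : ι → Set κ} {D : κ → Set κ}
    (hsep : ∀ j l, (∀ i, j ∈ A i ↔ l ∈ A i) → j = l)
    (hanti : ∀ j l, j ≠ l → ¬ D l ⊆ D j) (hD : ∀ i j, D j ⊆ A i ↔ j ∈ A i)
    (j l : κ) (hl : l ∈ D j) : l = j := by
  have hle : ∀ {j l}, l ∈ D j → {i | j ∈ A i} ⊆ {i | l ∈ A i} := fun {j l} hl i hi =>
    (hD i j).2 hi hl
  generalize hT : {i | j ∈ A i} = T
  induction T using WellFoundedGT.induction generalizing j l with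
  | ind T ih =>
    subst hT
    by_contra hne
    have hlt : {i | j ∈ A i} ⊂ {i | l ∈ A i} :=
      (hle hl).ssubset_of_ne fun h => hne (hsep _ _ fun i => Set.ext_iff.1 h i).symm
    refine hanti j l (Ne.symm hne) fun x hx => ?_
    rwa [ih _ hlt l x hx rfl]

/-- Whenever VertexTest accepts distributions of the span, the permuted candidates are the base
distributions. -/
theorem VertexTest.sound (hP : JointlyIrreducible P) {mixing : Matrix (Fin M) (Fin L) ℝ}
    (hmixing : ∀ i, mixing i ∈ stdSimplex ℝ (Fin L))
    (hS : Function.Injective (partialLabelMatrix mixing).col) {w : Fin L → Fin L → ℝ}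
    (hw : ∀ j, w j ∈ stdSimplex ℝ (Fin L)) {C : Matrix (Fin L) (Fin L) ℝ}
    (h : VertexTest (partialLabelMatrix mixing) (contaminated mixing P) (fun j => mix P (w j))
      (1, C)) (i : Fin L) : ∑ j, C i j • mix P (w j) = toSM (P i) := by
  cases h with
  | found C hoff hC hZ =>
    obtain ⟨σ, rfl⟩ := hC
    have hsupp : ∀ j l, l ∈ {l | 0 < w (σ.symm j) l} → l = j := by
      refine eq_of_mem_of_antichain (A := fun i => {l | 0 < mixing i l}) ?_ ?_ ?_
      · intro j l hjl
        refine hS (funext fun i => ?_)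
        simp only [Set.mem_ofPred_eq] at hjl
        simp [partialLabelMatrix, hjl i]
      · intro j l hjl hsub
        have := hoff (σ.symm j) (σ.symm l) (σ.symm.injective.ne hjl)
        exact (kappaPattern_mix_ne_zero_iff hP hw hw _ _).2 hsub this
      · intro i j
        have hij := congrFun (congrFun hZ i) j
        rw [mul_permMatrix_apply] at hij
        refine (kappaPattern_mix_ne_zero_iff hP hmixing hw i (σ.symm j)).symm.trans ?_
        change kappaPattern (contaminated mixing P) _ i (σ.symm j) ≠ 0 ↔ _
        rw [hij]
        simp [partialLabelMatrix]
    have hw' : w (σ.symm i) = Pi.single i 1 :=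
      eq_single_of_mem_stdSimplex (hw _) fun l hl => by
        by_contra hne
        exact hl (hsupp i l (lt_of_le_of_ne ((hw _).1 l) (Ne.symm hne)))
    rw [Finset.sum_eq_single (σ.symm i), hw', mix_single]
    · simp [Equiv.Perm.permMatrix, PEquiv.toMatrix_apply]
    · intro j _ hj
      simp [Equiv.Perm.permMatrix, PEquiv.toMatrix_apply, Equiv.eq_symm_apply] at hj ⊢
      simp [hj]
    · simp

/-- VertexTest does not reject a permutation of the base distributions. -/
theorem VertexTest.not_reject (hP : JointlyIrreducible P) {mixing : Matrix (Fin M) (Fin L) ℝ}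
    (hmixing : ∀ i, mixing i ∈ stdSimplex ℝ (Fin L)) {τ : Fin L → Fin L}
    (hτ : Function.Injective τ) (C : Matrix (Fin L) (Fin L) ℝ) :
    ¬ VertexTest (partialLabelMatrix mixing) (contaminated mixing P)
      (fun j => mix P (Pi.single (τ j) 1)) (0, C) := by
  have hw : ∀ j, (Pi.single (τ j) 1 : Fin L → ℝ) ∈ stdSimplex ℝ (Fin L) := fun j =>
    single_mem_stdSimplex ℝ (τ j)
  intro h
  cases h with
  | offDiagonal hex =>
    obtain ⟨i, j, hij, hne⟩ := hex
    have := (kappaPattern_mix_ne_zero_iff hP hw hw i j).1 hne (τ j) (by simp)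
    rw [Pi.single_eq_of_ne (hτ.ne hij.symm)] at this
    exact lt_irrefl _ this
  | notFound _ hno =>
    refine hno ⟨_, ⟨Equiv.ofBijective τ (Finite.injective_iff_bijective.1 hτ), rfl⟩, ?_⟩
    set σ := Equiv.ofBijective τ (Finite.injective_iff_bijective.1 hτ)
    ext i j
    have hτσ : τ (σ.symm j) = j := σ.apply_symm_apply j
    have hiff : 0 < kappaStar (contaminated mixing P i) (mix P (Pi.single (τ (σ.symm j)) 1)) ↔
        0 < mixing i j := by
      rw [contaminated_eq_mix, hP.kappaStar_pos_iff (hmixing i) (hw _), hτσ]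
      refine ⟨fun h => h j (by simp), fun h l hl => ?_⟩
      rcases eq_or_ne l j with rfl | hne
      · exact h
      · simp [hne] at hl
    rw [mul_permMatrix_apply]
    simp only [kappaPattern, partialLabelMatrix, Matrix.of_apply, hiff]

end VertexTest

/-! ### A single call of `sol` -/

section Sol

variable {X : Type*} [MeasurableSpace X] {L : ℕ} {P : Fin L → ProbabilityMeasure X}

/-- Coordinates of the argument `(1 / k) Q i + (1 - 1 / k) Q̄ i` of `sol`, where `m i` stands for
`Q i` and `m j` with `j ≠ i` for the distributions that are averaged in `Q̄ i`. -/
noncomputable def solArg (m : Fin L → Fin L → ℝ) (k : ℕ) (i : Fin L) : Fin L → ℝ :=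
  (1 / (k : ℝ)) • m i + (1 - 1 / (k : ℝ)) • (1 / ((L : ℝ) - 1)) • ∑ j : {j // j ≠ i}, m j

theorem solArg_mem (hL : 2 ≤ L) {m : Fin L → Fin L → ℝ} (hm : ∀ j, m j ∈ stdSimplex ℝ (Fin L))
    {k : ℕ} (hk : 1 ≤ k) (i : Fin L) : solArg m k i ∈ stdSimplex ℝ (Fin L) := by
  have hL' : (0 : ℝ) < L - 1 := by
    have : (2 : ℝ) ≤ L := by exact_mod_cast hL
    linarith
  have hk' : (1 : ℝ) ≤ k := by exact_mod_cast hk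
  have hcard : ((Fintype.card {j : Fin L // j ≠ i} : ℕ) : ℝ) = (L : ℝ) - 1 := by
    rw [Fintype.card_subtype_compl, Fintype.card_fin, Fintype.card_subtype_eq,
      Nat.cast_sub (by lia), Nat.cast_one]
  have hconv := convex_stdSimplex ℝ (Fin L)
  refine hconv (hm i) ?_ (by positivity) (sub_nonneg.2 ((div_le_one (by linarith)).2 hk'))
    (by ring)
  rw [Finset.smul_sum]
  refine hconv.sum_mem (fun _ _ => by positivity) ?_ fun j _ => hm j
  rw [Finset.sum_const, Finset.card_univ, nsmul_eq_mul, hcard]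
  field_simp

theorem map_solArg {m : Fin L → Fin L → ℝ} {i : Fin L} {h : (Fin L → ℝ) →ₗ[ℝ] ℝ}
    (hi : h (m i) = 1) (hj : ∀ j, j ≠ i → h (m j) = 0) (k : ℕ) :
    h (solArg m k i) = 1 / (k : ℝ) := by
  have h0 : ∑ j : {j // j ≠ i}, h (m j) = 0 := Finset.sum_eq_zero fun j _ => hj j j.2
  simp [solArg, hi, h0]

/-- The height of a residue `g` above the hyperplane `ker h` spanned by the `m j` with `j ≠ i` is
inversely proportional to the weight `1 - ∑ j, ν j`. -/
theorem weight_mul_height {m : Fin L → Fin L → ℝ} {i : Fin L} {h : (Fin L → ℝ) →ₗ[ℝ] ℝ}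
    (hi : h (m i) = 1) (hj : ∀ j, j ≠ i → h (m j) = 0) {k : ℕ} {ν : {j // j ≠ i} → ℝ}
    {g : Fin L → ℝ} (hg : solArg m k i = (1 - ∑ j, ν j) • g + ∑ j, ν j • m j) :
    (1 - ∑ j, ν j) * h g = 1 / (k : ℝ) := by
  have h0 : ∑ j : {j // j ≠ i}, ν j * h (m j) = 0 :=
    Finset.sum_eq_zero fun j _ => by rw [hj j j.2, mul_zero]
  rw [← map_solArg hi hj k, hg]
  simp [h0]

/-- The call of `sol` is defined: the total weight cannot be `1`, as the argument of `sol` has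
positive height. -/
theorem JointlyIrreducible.exists_isSol (hP : JointlyIrreducible P) (hL : 2 ≤ L)
    {m : Fin L → Fin L → ℝ} (hm : ∀ j, m j ∈ stdSimplex ℝ (Fin L))
    {k : ℕ} (hk : 1 ≤ k) {i : Fin L} {h : (Fin L → ℝ) →ₗ[ℝ] ℝ} (hi : h (m i) = 1)
    (hj : ∀ j, j ≠ i → h (m j) = 0) :
    ∃ G, IsSol (mix P (solArg m k i)) (fun j : {j // j ≠ i} => mix P (m j)) G := by
  have hc := solArg_mem hL hm hk i
  obtain ⟨ν, hν⟩ := hP.exists_attainsKappaStar hc fun j : {j // j ≠ i} => m j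
  obtain ⟨-, -, g, -, heq⟩ := (hP.feasible_mix_iff hc _ ν).1 hν.1
  refine ⟨_, ν, hν, fun h0 => ?_, rfl⟩
  have hw := weight_mul_height hi hj heq
  rw [h0, zero_mul] at hw
  have : (0 : ℝ) < 1 / k := by positivity
  exact this.ne hw

/-- The residue returned by `sol` lies in the span, and the weights can be read in coordinates. -/
theorem IsSol.exists_coords (hP : JointlyIrreducible P) {ι : Type*} [Fintype ι] {c : Fin L → ℝ}
    (hc : c ∈ stdSimplex ℝ (Fin L)) {f : ι → Fin L → ℝ} {G : SignedMeasure X}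
    (hG : IsSol (mix P c) (fun j => mix P (f j)) G) :
    ∃ ν g, AttainsKappaStar (mix P c) (fun j => mix P (f j)) ν ∧ 0 < 1 - ∑ j, ν j ∧
      g ∈ stdSimplex ℝ (Fin L) ∧ c = (1 - ∑ j, ν j) • g + ∑ j, ν j • f j ∧ G = mix P g := by
  obtain ⟨ν, hν, h0, rfl⟩ := hG
  obtain ⟨-, h1, g, hg, heq⟩ := (hP.feasible_mix_iff hc _ ν).1 hν.1
  refine ⟨ν, g, hν, lt_of_le_of_ne (sub_nonneg.2 h1) (Ne.symm h0), hg, heq, ?_⟩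
  conv_lhs => rw [heq]
  simp only [map_add, map_smul, map_sum]
  rw [add_sub_cancel_right, smul_smul, inv_mul_cancel₀ h0, one_smul]

theorem IsSol.exists_height_pos (hP : JointlyIrreducible P) (hL : 2 ≤ L)
    {m : Fin L → Fin L → ℝ} (hm : ∀ j, m j ∈ stdSimplex ℝ (Fin L))
    {k : ℕ} (hk : 1 ≤ k) {i : Fin L} {h : (Fin L → ℝ) →ₗ[ℝ] ℝ} (hi : h (m i) = 1)
    (hj : ∀ j, j ≠ i → h (m j) = 0) {G : SignedMeasure X}
    (hG : IsSol (mix P (solArg m k i)) (fun j : {j // j ≠ i} => mix P (m j)) G) :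
    ∃ g ∈ stdSimplex ℝ (Fin L), 0 < h g ∧ G = mix P g := by
  obtain ⟨ν, g, -, hpos, hg, heq, hGg⟩ := hG.exists_coords hP (solArg_mem hL hm hk i)
  refine ⟨g, hg, pos_of_mul_pos_right ?_ hpos.le, hGg⟩
  rw [weight_mul_height hi hj heq]
  positivity

theorem map_eq_sum_single (h : (Fin L → ℝ) →ₗ[ℝ] ℝ) (g : Fin L → ℝ) :
    h g = ∑ a, g a * h (Pi.single a 1) := by
  conv_lhs => rw [pi_eq_sum_univ' g]
  simp only [map_sum, map_smul, smul_eq_mul]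

/-- A linear functional with a unique maximal vertex attains its maximum over the simplex only
there. -/
theorem eq_single_of_le {h : (Fin L → ℝ) →ₗ[ℝ] ℝ} {l : Fin L}
    (hl : ∀ a, a ≠ l → h (Pi.single a 1) < h (Pi.single l 1)) {g : Fin L → ℝ}
    (hg : g ∈ stdSimplex ℝ (Fin L)) (hle : h (Pi.single l 1) ≤ h g) : g = Pi.single l 1 := by
  have hsum : ∑ a, g a * (h (Pi.single l 1) - h (Pi.single a 1)) ≤ 0 := by
    simp only [mul_sub, Finset.sum_sub_distrib, ← Finset.sum_mul, hg.2, ← map_eq_sum_single]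
    linarith
  have hnn : ∀ a ∈ Finset.univ, 0 ≤ g a * (h (Pi.single l 1) - h (Pi.single a 1)) := fun a _ => by
    rcases eq_or_ne a l with rfl | ha
    · simp
    · exact mul_nonneg (hg.1 a) (sub_nonneg.2 (hl a ha).le)
  have h0 := (Finset.sum_eq_zero_iff_of_nonneg hnn).1 (hsum.antisymm (Finset.sum_nonneg hnn))
  exact eq_single_of_mem_stdSimplex hg fun a ha =>
    (mul_eq_zero.1 (h0 a (Finset.mem_univ a))).resolve_right (sub_pos.2 (hl a ha)).ne'

/-- For large `k` the argument of `sol` is so close to the average of the `m j` with `j ≠ i` that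
moving away from the vertex `l` to the hyperplane `ker h` keeps the weights nonnegative. Hence
`sol` is free to choose a residue of maximal height, which is the vertex `l`. -/
theorem IsSol.eventually_eq_vertex (hP : JointlyIrreducible P) (hL : 2 ≤ L)
    {m : Fin L → Fin L → ℝ} (hm : ∀ j, m j ∈ stdSimplex ℝ (Fin L))
    (hspan : Submodule.span ℝ (Set.range m) = ⊤) {i : Fin L} {h : (Fin L → ℝ) →ₗ[ℝ] ℝ}
    (hi : h (m i) = 1) (hj : ∀ j, j ≠ i → h (m j) = 0) {l : Fin L}
    (hl : ∀ a, a ≠ l → h (Pi.single a 1) < h (Pi.single l 1)) (hpos : 0 < h (Pi.single l 1)) :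
    ∀ᶠ k : ℕ in Filter.atTop, ∀ G,
      IsSol (mix P (solArg m k i)) (fun j : {j // j ≠ i} => mix P (m j)) G →
        G = mix P (Pi.single l 1) := by
  obtain ⟨c, hc⟩ := (Submodule.mem_span_range_iff_exists_fun ℝ).1
    (hspan ▸ Submodule.mem_top : (Pi.single l 1 : Fin L → ℝ) ∈ Submodule.span ℝ (Set.range m))
  have hsplit : ∀ F : Fin L → Fin L → ℝ, ∑ j, F j = F i + ∑ j : {j // j ≠ i}, F j := fun F =>
    (Fintype.sum_eq_add_sum_subtype_ne F i)
  have hci : c i = h (Pi.single l 1) := by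
    have h0 : ∑ j : {j // j ≠ i}, c j * h (m j) = 0 :=
      Finset.sum_eq_zero fun j _ => by rw [hj j j.2, mul_zero]
    rw [← hc, hsplit]
    simp [hi, h0]
  set η := h (Pi.single l 1) with hη
  have hL' : (0 : ℝ) < L - 1 := by
    have : (2 : ℝ) ≤ L := by exact_mod_cast hL
    linarith
  -- the weights for which the residue is the vertex `l`
  let ν : ℕ → {j // j ≠ i} → ℝ := fun k j =>
    (1 - 1 / (k : ℝ)) * (1 / ((L : ℝ) - 1)) - 1 / (k : ℝ) * (c j / η)
  have hνpos : ∀ᶠ k in Filter.atTop, ∀ j, 0 ≤ ν k j := by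
    refine Filter.eventually_all.2 fun j => ?_
    have h1 : Filter.Tendsto (fun k : ℕ => 1 / (k : ℝ)) Filter.atTop (nhds 0) :=
      tendsto_one_div_atTop_nhds_zero_nat
    have ht : Filter.Tendsto (fun k => ν k j) Filter.atTop
        (nhds ((1 - 0) * (1 / ((L : ℝ) - 1)) - 0 * (c j / η))) :=
      ((h1.const_sub 1).mul_const _).sub (h1.mul_const _)
    have hlim : 0 < (1 - 0) * (1 / ((L : ℝ) - 1)) - 0 * (c j / η) := by
      rw [sub_zero, one_mul, zero_mul, sub_zero]
      positivity
    exact (ht.eventually_const_lt hlim).mono fun k hk => hk.le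
  filter_upwards [hνpos, Filter.eventually_ge_atTop 1] with k hν0 hk G hG
  have hk' : (0 : ℝ) < k := by exact_mod_cast hk
  have harg := solArg_mem hL hm hk i
  have heq : solArg m k i = (1 / (k * η)) • Pi.single l 1 + ∑ j, ν k j • m j := by
    rw [← hc, hsplit, hci, smul_add, smul_smul, Finset.smul_sum, add_assoc,
      ← Finset.sum_add_distrib, solArg, smul_smul, Finset.smul_sum]
    congr 1
    · congr 1
      field_simp
    · refine Finset.sum_congr rfl fun j _ => ?_
      rw [smul_smul, ← add_smul]
      congr 1
      simp only [ν]
      field_simp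
      ring
  -- comparing total masses gives the weight of the vertex
  have hmass : 1 / (k * η) = 1 - ∑ j, ν k j := by
    obtain ⟨T, hT⟩ : ∃ T : (Fin L → ℝ) →ₗ[ℝ] ℝ, ∀ v, T v = ∑ a, v a :=
      ⟨∑ a, LinearMap.proj a, fun v => by simp⟩
    have hs := congrArg T heq
    simp only [map_add, map_smul, map_sum, smul_eq_mul] at hs
    simp only [hT, (hm _).2, harg.2, (single_mem_stdSimplex ℝ l).2, mul_one] at hs
    linarith
  rw [hmass] at heq
  have hwt : 0 < 1 - ∑ j, ν k j := by rw [← hmass]; positivity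
  have hfeas := (hP.feasible_mix_iff harg (fun j : {j // j ≠ i} => m j) (ν k)).2
    ⟨hν0, (sub_pos.1 hwt).le, _, single_mem_stdSimplex ℝ l, heq⟩
  obtain ⟨ν', g, hatt, hpos', hg, heq', rfl⟩ := hG.exists_coords hP harg
  have hle := hatt.2 _ hfeas
  have e1 := weight_mul_height hi hj heq
  have e2 := weight_mul_height hi hj heq'
  rw [eq_single_of_le hl hg ?_]
  by_contra! hlt
  have := mul_lt_mul_of_pos_left hlt hpos'
  have := mul_le_mul_of_nonneg_right (sub_le_sub_left hle 1) hpos.le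
  linarith

end Sol

/-! ### The families met by the inner loop -/

section Families

variable {L : ℕ}

/-- Coordinates of the family in use when the inner loop is about to treat index `i`: the entries
`w j` already computed for `j < i`, and the draws `q j` for `j ≥ i`. -/
def currentFamily (q w : Fin L → Fin L → ℝ) (i : ℕ) : Fin L → Fin L → ℝ :=
  fun j => if (j : ℕ) < i then w j else q j

theorem currentFamily_zero (q w : Fin L → Fin L → ℝ) : currentFamily q w 0 = q := by
  ext j; simp [currentFamily]

theorem currentFamily_self (q w : Fin L → Fin L → ℝ) : currentFamily q w L = w := by
  ext j; simp [currentFamily]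

theorem currentFamily_mem {q w : Fin L → Fin L → ℝ} (hq : ∀ j, q j ∈ stdSimplex ℝ (Fin L))
    (hw : ∀ j, w j ∈ stdSimplex ℝ (Fin L)) (i : ℕ) (j : Fin L) :
    currentFamily q w i j ∈ stdSimplex ℝ (Fin L) := by
  unfold currentFamily
  split_ifs
  exacts [hw j, hq j]

theorem currentFamily_succ (q w : Fin L → Fin L → ℝ) (i : Fin L) (g : Fin L → ℝ) :
    currentFamily q (Function.update w i g) (i + 1) =
      Function.update (currentFamily q w i) i g := by
  ext j : 1
  rcases eq_or_ne j i with rfl | hj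
  · simp [currentFamily]
  · have : (j : ℕ) ≠ i := fun h => hj (Fin.ext h)
    have h' : (j : ℕ) < i + 1 ↔ (j : ℕ) < i := by lia
    simp [currentFamily, hj, h']

theorem exists_coord {m : Fin L → Fin L → ℝ} (hm : LinearIndependent ℝ m) (i : Fin L) :
    ∃ h : (Fin L → ℝ) →ₗ[ℝ] ℝ, h (m i) = 1 ∧ ∀ j, j ≠ i → h (m j) = 0 := by
  have : Nonempty (Fin L) := ⟨i⟩
  let b := basisOfLinearIndependentOfCardEqFinrank hm (by simp)
  have hb : ∀ j, b j = m j := fun j => by simp [b]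
  refine ⟨b.coord i, ?_, fun j hj => ?_⟩
  · rw [← hb]; simp
  · rw [← hb]; simp [hj.symm]

theorem span_eq_top {m : Fin L → Fin L → ℝ} (hm : LinearIndependent ℝ m) :
    Submodule.span ℝ (Set.range m) = ⊤ :=
  hm.span_eq_top_of_card_eq_finrank' (by simp)

theorem linearIndependent_update {m : Fin L → Fin L → ℝ} (hm : LinearIndependent ℝ m) {i : Fin L}
    {h : (Fin L → ℝ) →ₗ[ℝ] ℝ} (hj : ∀ j, j ≠ i → h (m j) = 0) {g : Fin L → ℝ} (hg : h g ≠ 0) :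
    LinearIndependent ℝ (Function.update m i g) := by
  rw [Fintype.linearIndependent_iff] at hm ⊢
  intro c hc
  have hci : c i = 0 := by
    have := congrArg h hc
    rw [map_sum, Finset.sum_eq_single i (fun j _ hne => by simp [hne, hj j hne]) (by simp)] at this
    simpa [hg] using this
  refine hm c ?_
  rw [← hc]
  refine Finset.sum_congr rfl fun j _ => ?_
  rcases eq_or_ne j i with rfl | hne
  · simp [hci]
  · simp [hne]

/-- General position of the draws: they are linearly independent, and remain so together with any
vertices found before them and the direction of an edge between two vertices not yet found. -/
structure InGeneralPosition (q : Fin L → Fin L → ℝ) : Prop where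
  linearIndependent : LinearIndependent ℝ q
  edge : ∀ (i : Fin L) (σ : Fin L → Fin L) (a b : Fin L), Set.InjOn σ (Set.Iio i) → a ≠ b →
    (∀ j < i, σ j ≠ a) → (∀ j < i, σ j ≠ b) → LinearIndependent ℝ fun j =>
      if j < i then (Pi.single (σ j) 1 : Fin L → ℝ)
      else if j = i then Pi.single a 1 - Pi.single b 1 else q j

/-- In general position the height above the hyperplane through the other members of the family has
a unique maximum over the vertices: two maximal vertices would span an edge parallel to the
hyperplane. -/
theorem InGeneralPosition.exists_unique_max {q : Fin L → Fin L → ℝ} (hgen : InGeneralPosition q)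
    (hq : ∀ j, q j ∈ stdSimplex ℝ (Fin L)) {i : Fin L} {σ : Fin L → Fin L}
    (hm : LinearIndependent ℝ (currentFamily q (fun j => Pi.single (σ j) 1) i))
    {h : (Fin L → ℝ) →ₗ[ℝ] ℝ} (hi : h (currentFamily q (fun j => Pi.single (σ j) 1) i i) = 1)
    (hj : ∀ j, j ≠ i → h (currentFamily q (fun j => Pi.single (σ j) 1) i j) = 0) :
    ∃ l, (∀ a, a ≠ l → h (Pi.single a 1) < h (Pi.single l 1)) ∧ 0 < h (Pi.single l 1) := by
  have hlt : ∀ j < i, currentFamily q (fun j => Pi.single (σ j) 1) i j = Pi.single (σ j) 1 :=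
    fun j hji => if_pos hji
  have hge : ∀ j, ¬ j < i → currentFamily q (fun j => Pi.single (σ j) 1) i j = q j :=
    fun j hji => if_neg hji
  obtain ⟨l, -, hl⟩ := Finset.exists_max_image Finset.univ
    (fun a => h (Pi.single a 1)) ⟨i, Finset.mem_univ i⟩
  have hpos : 0 < h (Pi.single l 1) := by
    have h1 : (1 : ℝ) ≤ ∑ a, q i a * h (Pi.single l 1) := by
      conv_lhs => rw [← hi, hge i (lt_irrefl i), map_eq_sum_single]
      exact Finset.sum_le_sum fun a _ =>
        mul_le_mul_of_nonneg_left (hl a (Finset.mem_univ a)) ((hq i).1 a)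
    rw [← Finset.sum_mul, (hq i).2, one_mul] at h1
    linarith
  refine ⟨l, fun a ha => lt_of_le_of_ne (hl a (Finset.mem_univ a)) fun heq => ?_, hpos⟩
  have hσ : ∀ j < i, h (Pi.single (σ j) 1) = 0 := fun j hji => by
    rw [← hlt j hji]; exact hj j hji.ne
  have hind := hgen.edge i σ a l
    (fun j hj' k hk' hjk => hm.injective (by rw [hlt j hj', hlt k hk', hjk])) ha
    (fun j hji hja => by
      have := hσ j hji
      rw [hja, heq] at this
      exact hpos.ne' this)
    (fun j hji hjl => by
      have := hσ j hji
      rw [hjl] at this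
      exact hpos.ne' this)
  have hzero : h = 0 := by
    refine LinearMap.ext_on_range (span_eq_top hind) fun j => ?_
    split_ifs with h1 h2
    · rw [hσ j h1, LinearMap.zero_apply]
    · rw [map_sub, heq, sub_self, LinearMap.zero_apply]
    · rw [← hge j h1, hj j h2, LinearMap.zero_apply]
  rw [hzero] at hi
  exact zero_ne_one hi

end Families

/-! ### PartialLabel for draws in general position -/

section Algorithm

variable {X : Type*} [MeasurableSpace X] {L M : ℕ} {P : Fin L → ProbabilityMeasure X}

theorem sol_arg_eq (q w : Fin L → Fin L → ℝ) (k : ℕ) (i : Fin L) :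
    (1 / (k : ℝ)) • mix P (q i) +
        (1 - 1 / (k : ℝ)) • average (fun j => mix P (q j)) (fun j => mix P (w j)) i =
      mix P (solArg (currentFamily q w i) k i) := by
  have hsum : ∑ j ∈ Finset.Ioi i, q j + ∑ j ∈ Finset.Iio i, w j =
      ∑ j : {j // j ≠ i}, currentFamily q w i j := by
    have hcompl : (Finset.univ.filter fun j : Fin L => j ≠ i) =
        (Finset.Ioi i).disjUnion (Finset.Iio i)
          (Finset.disjoint_left.2 fun j h1 h2 => by simp at h1 h2; exact lt_asymm h1 h2) := by
      ext j
      simp [← lt_or_lt_iff_ne, or_comm]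
    rw [← Finset.sum_subtype (Finset.univ.filter fun j : Fin L => j ≠ i) (by simp)
      (currentFamily q w i), hcompl, Finset.sum_disjUnion]
    refine congrArg₂ _ (Finset.sum_congr rfl fun j hj => ?_) (Finset.sum_congr rfl fun j hj => ?_)
    · exact (if_neg (not_lt.2 (Finset.mem_Ioi.1 hj).le)).symm
    · exact (if_pos (Finset.mem_Iio.1 hj)).symm
  have hself : currentFamily q w i i = q i := if_neg (lt_irrefl _)
  rw [solArg, ← hsum, hself]
  simp only [average, map_add, map_smul, map_sum]

theorem others_eq (q w : Fin L → Fin L → ℝ) (i : Fin L) :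
    others (fun j => mix P (q j)) (fun j => mix P (w j)) i =
      fun j : {j // j ≠ i} => mix P (currentFamily q w i j) := by
  ext1 j
  rcases lt_or_gt_of_ne j.2 with h | h
  · have h' : ((j : Fin L) : ℕ) < i := h
    simp [others, currentFamily, h', not_lt.2 h.le]
  · have h' : ¬ ((j : Fin L) : ℕ) < i := not_lt.2 (le_of_lt h)
    simp [others, currentFamily, h', h]

/-- Once `k` is large, `sol` returns vertices as long as it has returned vertices so far in the
same pass of the inner loop. One bound on `k` works, since there are finitely many such pasts. -/
theorem InGeneralPosition.eventually_isSol_vertex (hP : JointlyIrreducible P) (hL : 2 ≤ L)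
    {q : Fin L → Fin L → ℝ} (hgen : InGeneralPosition q)
    (hq : ∀ j, q j ∈ stdSimplex ℝ (Fin L)) :
    ∀ᶠ k : ℕ in Filter.atTop, ∀ (i : Fin L) (σ : Fin L → Fin L),
      LinearIndependent ℝ (currentFamily q (fun j => Pi.single (σ j) 1) i) → ∀ G,
      IsSol (mix P (solArg (currentFamily q (fun j => Pi.single (σ j) 1) i) k i))
        (fun j : {j // j ≠ i} => mix P (currentFamily q (fun j => Pi.single (σ j) 1) i j)) G →
      ∃ l, G = mix P (Pi.single l 1) := by
  refine Filter.eventually_all.2 fun i => Filter.eventually_all.2 fun σ => ?_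
  by_cases hm : LinearIndependent ℝ (currentFamily q (fun j => Pi.single (σ j) 1) i)
  · obtain ⟨h, hi, hj⟩ := exists_coord hm i
    obtain ⟨l, hl, hpos⟩ := hgen.exists_unique_max hq hm hi hj
    filter_upwards [IsSol.eventually_eq_vertex hP hL
      (currentFamily_mem hq (fun j => single_mem_stdSimplex ℝ (σ j)) i) (span_eq_top hm) hi hj hl
      hpos] with k hk _ G hG
    exact ⟨l, hk G hG⟩
  · exact .of_forall fun k h => absurd h hm

/-- The invariant of PartialLabel, with a threshold `K` on the counter after which `sol` returns
vertices. -/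
def Invariant (P : Fin L → ProbabilityMeasure X) (q : Fin L → Fin L → ℝ) (K : ℕ) :
    State X L → Prop
  | .run k i W => 2 ≤ k ∧ i ≤ L ∧ ∃ w : Fin L → Fin L → ℝ, (∀ j, w j ∈ stdSimplex ℝ (Fin L)) ∧
      W = (fun j => mix P (w j)) ∧ LinearIndependent ℝ (currentFamily q w i) ∧
      (K ≤ k → ∀ j : Fin L, (j : ℕ) < i → ∃ a, w j = Pi.single a 1)
  | .halt R => R = fun j => toSM (P j)

variable {mixing : Matrix (Fin M) (Fin L) ℝ}

theorem Invariant.step (hP : JointlyIrreducible P) (hL : 2 ≤ L)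
    (hmixing : ∀ i, mixing i ∈ stdSimplex ℝ (Fin L))
    (hS : Function.Injective (partialLabelMatrix mixing).col)
    {q : Fin L → Fin L → ℝ} (hq : ∀ j, q j ∈ stdSimplex ℝ (Fin L))
    (hgen : LinearIndependent ℝ q) {K : ℕ}
    (hK : ∀ k ≥ K, ∀ (i : Fin L) (σ : Fin L → Fin L),
      LinearIndependent ℝ (currentFamily q (fun j => Pi.single (σ j) 1) i) → ∀ G,
      IsSol (mix P (solArg (currentFamily q (fun j => Pi.single (σ j) 1) i) k i))
        (fun j : {j // j ≠ i} => mix P (currentFamily q (fun j => Pi.single (σ j) 1) i j)) G →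
      ∃ l, G = mix P (Pi.single l 1)) {s t : State X L}
    (hs : Invariant P q K s)
    (hst : Step (partialLabelMatrix mixing) (contaminated mixing P) (fun j => mix P (q j)) s t) :
    Invariant P q K t := by
  cases hst with
  | solve k i W hi G hG =>
    obtain ⟨hk, -, w, hw, rfl, hind, hvert⟩ := hs
    rw [sol_arg_eq q w k ⟨i, hi⟩, others_eq] at hG
    obtain ⟨h, h1, h0⟩ := exists_coord hind ⟨i, hi⟩
    obtain ⟨g, hg, hpos, rfl⟩ := hG.exists_height_pos hP hL (currentFamily_mem hq hw i)
      (by lia) h1 h0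
    refine ⟨hk, hi, Function.update w ⟨i, hi⟩ g, fun j => ?_, ?_, ?_, fun hKk j hj => ?_⟩
    · rcases eq_or_ne j ⟨i, hi⟩ with rfl | hne
      · rwa [Function.update_self]
      · rw [Function.update_of_ne hne]; exact hw j
    · ext1 j
      rcases eq_or_ne j ⟨i, hi⟩ with rfl | hne
      · simp
      · simp [hne]
    · have := currentFamily_succ q w ⟨i, hi⟩ g
      simp only at this
      rw [this]
      exact linearIndependent_update hind h0 hpos.ne'
    · rcases eq_or_ne j ⟨i, hi⟩ with rfl | hne
      · rw [Function.update_self]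
        choose! σ hσ using hvert hKk
        have hfam : currentFamily q w i = currentFamily q (fun j => Pi.single (σ j) 1) i := by
          ext1 j
          unfold currentFamily
          split_ifs with hji
          exacts [hσ j hji, rfl]
        rw [hfam] at hind hG
        obtain ⟨l, hl⟩ := hK k hKk ⟨i, hi⟩ σ hind _ hG
        exact ⟨l, hP.mix_injective hl⟩
      · rw [Function.update_of_ne hne]
        have : (j : ℕ) ≠ i := fun h => hne (Fin.ext h)
        exact hvert hKk j (by lia)
  | retry k W C _ =>
    obtain ⟨hk, -, w, hw, rfl, -, -⟩ := hs
    refine ⟨by lia, Nat.zero_le _, w, hw, rfl, ?_, fun _ j hj => absurd hj (Nat.not_lt_zero _)⟩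
    rwa [currentFamily_zero]
  | accept k W C hV =>
    obtain ⟨hk, -, w, hw, rfl, -, -⟩ := hs
    exact funext (hV.sound hP hmixing hS hw)

/-- After the threshold, VertexTest is applied to a permutation of the base distributions and does
not send the algorithm back. -/
theorem Invariant.not_reject (hP : JointlyIrreducible P)
    (hmixing : ∀ i, mixing i ∈ stdSimplex ℝ (Fin L)) {q : Fin L → Fin L → ℝ} {K : ℕ}
    {W : Fin L → SignedMeasure X} (hs : Invariant P q K (.run K L W))
    (C : Matrix (Fin L) (Fin L) ℝ) :
    ¬ VertexTest (partialLabelMatrix mixing) (contaminated mixing P) W (0, C) := by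
  obtain ⟨-, -, w, -, rfl, hind, hvert⟩ := hs
  rw [currentFamily_self] at hind
  choose τ hτ using fun j : Fin L => hvert le_rfl j j.2
  obtain rfl : w = fun j => Pi.single (τ j) 1 := funext hτ
  exact VertexTest.not_reject hP hmixing
    (fun i j hij => hind.injective (congrArg (fun a => (Pi.single a 1 : Fin L → ℝ)) hij)) C

theorem exists_vertexTest {m n : ℕ} (S : Matrix (Fin m) (Fin n) ℝ) (F : Fin m → SignedMeasure X)
    (W : Fin n → SignedMeasure X) :
    (∃ C, VertexTest S F W (0, C)) ∨ ∃ C, VertexTest S F W (1, C) := by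
  by_cases h : ∃ i j, i ≠ j ∧ kappaPattern W W i j ≠ 0
  · exact .inl ⟨0, .offDiagonal h⟩
  · push Not at h
    by_cases hC : ∃ C : Matrix (Fin n) (Fin n) ℝ, IsPermMatrix C ∧ kappaPattern F W * C = S
    · obtain ⟨C, h1, h2⟩ := hC
      exact .inr ⟨_, .found C h h1 h2⟩
    · exact .inl ⟨0, .notFound h hC⟩

/-- The deterministic part of the argument: in general position the counter cannot pass the
threshold, and the algorithm can only be stuck after it has returned the base distributions. -/
theorem partialLabelReturns_of_inGeneralPosition (hP : JointlyIrreducible P) (hL : 2 ≤ L)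
    (hmixing : ∀ i, mixing i ∈ stdSimplex ℝ (Fin L))
    (hS : Function.Injective (partialLabelMatrix mixing).col)
    {q : Fin L → Fin L → ℝ} (hq : ∀ j, q j ∈ stdSimplex ℝ (Fin L)) (hgen : InGeneralPosition q) :
    PartialLabelReturns (partialLabelMatrix mixing) (contaminated mixing P)
      (fun j => mix P (q j)) fun j => toSM (P j) := by
  obtain ⟨K₀, hK₀⟩ := Filter.eventually_atTop.1 (hgen.eventually_isSol_vertex hP hL hq)
  let K := max K₀ 2
  have hK := fun k (hk : k ≥ K) => hK₀ k ((le_max_left _ _).trans hk)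
  have hinit : Invariant P q K (.run 2 0 fun j => mix P (q j)) :=
    ⟨le_rfl, Nat.zero_le _, q, hq, rfl, by rw [currentFamily_zero]; exact hgen.linearIndependent,
      fun _ j hj => absurd hj (Nat.not_lt_zero _)⟩
  have hstep := fun {s t : State X L} => Invariant.step (s := s) (t := t) hP hL hmixing hS hq
    hgen.linearIndependent hK
  constructor
  · rintro ⟨s, hs0, hs⟩
    have hinv : ∀ n, Invariant P q K (s n) := fun n => by
      induction n with
      | zero => rw [hs0]; exact hinit
      | succ n ih => exact hstep ih (hs n)
    -- along an infinite run, `k * (L + 1) + i` increases by one in each step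
    have hrun : ∀ n, ∃ k i W, s n = .run k i W ∧ k * (L + 1) + i = 2 * (L + 1) + n := fun n => by
      induction n with
      | zero => exact ⟨2, 0, _, hs0, rfl⟩
      | succ n ih =>
        obtain ⟨k, i, W, hsn, hki⟩ := ih
        have hn := hs n
        rw [hsn] at hn
        generalize hsn' : s (n + 1) = t at hn
        cases hn with
        | solve _ _ _ hi G _ => exact ⟨_, _, _, rfl, by rw [← Nat.add_assoc, hki, Nat.add_assoc]⟩
        | retry _ _ C _ => exact ⟨_, _, _, rfl, by lia⟩
        | accept _ _ C _ =>
          have hn' := hs (n + 1)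
          rw [hsn'] at hn'
          cases hn'
    -- hence VertexTest is reached with counter `K`, and cannot be followed by two more steps
    obtain ⟨n, hn⟩ : ∃ n, 2 * (L + 1) + n = K * (L + 1) + L :=
      ⟨K * (L + 1) + L - 2 * (L + 1), by
        have : 2 * (L + 1) ≤ K * (L + 1) := Nat.mul_le_mul_right _ (le_max_right _ _)
        lia⟩
    obtain ⟨k, i, W, hsn, hki⟩ := hrun n
    have hI := hinv n
    rw [hsn] at hI
    have hiL : i ≤ L := hI.2.1
    have hkK : k = K := by
      have h1 := congrArg (· / (L + 1)) (hki.trans hn)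
      simpa [Nat.mul_add_div, Nat.add_div_of_dvd_right, Nat.div_eq_of_lt (Nat.lt_succ_of_le hiL),
        Nat.div_eq_of_lt (Nat.lt_succ_self L), mul_comm _ (L + 1)] using h1
    subst hkK
    obtain rfl : i = L := by lia
    have h1 := hs n
    rw [hsn] at h1
    generalize hsn' : s (n + 1) = t at h1
    cases h1 with
    | solve _ _ _ hi => exact lt_irrefl _ hi
    | retry _ _ C hV => exact hI.not_reject hP hmixing C hV
    | accept _ _ C _ =>
      have hn' := hs (n + 1)
      rw [hsn'] at hn'
      cases hn'
  · intro s hreach hstuck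
    have hI : Invariant P q K s := by
      clear hstuck
      induction hreach with
      | refl => exact hinit
      | tail _ hst ih => exact hstep ih hst
    cases s with
    | halt R => exact congrArg _ hI
    | run k i W =>
      obtain ⟨hk, hi, w, hw, rfl, hind, -⟩ := hI
      rcases hi.lt_or_eq with hi | rfl
      · obtain ⟨h, h1, h0⟩ := exists_coord hind ⟨i, hi⟩
        obtain ⟨G, hG⟩ := hP.exists_isSol hL (currentFamily_mem hq hw i) (k := k) (by lia) h1 h0
        refine absurd (Step.solve k i _ hi G ?_) (hstuck _)
        rwa [sol_arg_eq q w k ⟨i, hi⟩, others_eq]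
      · rcases exists_vertexTest (partialLabelMatrix mixing) (contaminated mixing P)
          (fun j => mix P (w j)) with ⟨C, hC⟩ | ⟨C, hC⟩
        · exact absurd (Step.retry k _ C hC) (hstuck _)
        · exact absurd (Step.accept k _ C hC) (hstuck _)

end Algorithm

/-! ### Random draws are in general position -/

section Random

theorem ae_mem_of_indepFun {Ω α β : Type*} [MeasurableSpace Ω] [MeasurableSpace α]
    [MeasurableSpace β] {Pr : Measure Ω} [IsProbabilityMeasure Pr] {Y : Ω → α} {Z : Ω → β}
    (hind : IndepFun Y Z Pr) (hY : Measurable Y) (hZ : Measurable Z) {s : Set (α × β)}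
    (hs : MeasurableSet s) (h : ∀ᵐ ω ∂Pr, ∀ᵐ z ∂Pr.map Z, (Y ω, z) ∈ s) :
    ∀ᵐ ω ∂Pr, (Y ω, Z ω) ∈ s := by
  have hprob := Measure.isProbabilityMeasure_map (μ := Pr) hZ.aemeasurable
  have hYZ := (indepFun_iff_map_prod_eq_prod_map_map hY.aemeasurable hZ.aemeasurable).1 hind
  refine (ae_map_iff (hY.prodMk hZ).aemeasurable hs).1 ?_
  rw [hYZ]
  refine (Measure.measure_prod_null hs.compl).2 ?_
  have hmeas := measurable_measure_prodMk_left (ν := Pr.map Z) hs.compl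
  exact (ae_map_iff hY.aemeasurable (measurableSet_eq_fun hmeas measurable_const)).2 h

/-- An affine map whose range spans the whole space avoids any proper subspace almost everywhere. -/
theorem ae_notMem_of_span_range_eq_top {d L : ℕ} (ψ : (Fin d → ℝ) →ᵃ[ℝ] (Fin L → ℝ))
    (hψ : Submodule.span ℝ (Set.range ψ) = ⊤) {V : Submodule ℝ (Fin L → ℝ)} (hV : V ≠ ⊤) :
    ∀ᵐ u, ψ u ∉ V := by
  have h0 : volume ((V.toAffineSubspace.comap ψ : AffineSubspace ℝ (Fin d → ℝ)) :
      Set (Fin d → ℝ)) = 0 := by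
    refine Measure.addHaar_affineSubspace _ _ fun htop => hV ?_
    rw [eq_top_iff, ← hψ, Submodule.span_le]
    rintro _ ⟨u, rfl⟩
    have : u ∈ V.toAffineSubspace.comap ψ := htop ▸ AffineSubspace.mem_top ℝ _ u
    exact this
  refine measure_mono_null (fun u hu => ?_) h0
  exact not_not.1 hu

/-- A linearly independent family on `D` almost surely stays so when it is completed, outside `D`,
by independent random points that avoid every fixed proper subspace almost surely. The points are
added one at a time: each is independent of the earlier ones, hence avoids their span. -/
theorem ae_linearIndependent {Ω : Type*} [MeasurableSpace Ω] {Pr : Measure Ω}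
    [IsProbabilityMeasure Pr] {d L : ℕ} {ψ : (Fin d → ℝ) →ᵃ[ℝ] (Fin L → ℝ)}
    (hψ : Submodule.span ℝ (Set.range ψ) = ⊤) {U : Fin L → Ω → Fin d → ℝ}
    (hU : ∀ i, Measurable (U i)) (hind : iIndepFun U Pr) (hac : ∀ i, Pr.map (U i) ≪ volume)
    (D : Finset (Fin L)) {f : Fin L → Fin L → ℝ} (hf : LinearIndepOn ℝ f (D : Set (Fin L))) :
    ∀ᵐ ω ∂Pr, LinearIndependent ℝ fun j => if j ∈ D then f j else ψ (U j ω) := by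
  let v : (Fin L → Fin d → ℝ) → Fin L → Fin L → ℝ := fun u j => if j ∈ D then f j else ψ (u j)
  have hψc : Continuous ψ := ψ.continuous_of_finiteDimensional
  have key : ∀ T : Finset (Fin L), Disjoint D T →
      ∀ᵐ ω ∂Pr, LinearIndepOn ℝ (v fun j => U j ω) ((D : Set (Fin L)) ∪ T) := by
    intro T
    induction T using Finset.induction_on with
    | empty =>
      refine fun _ => .of_forall fun ω => ?_
      rw [Finset.coe_empty, Set.union_empty]
      exact hf.congr fun j hj => (if_pos hj).symm
    | insert i T hiT ih =>
      intro hdisj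
      rw [Finset.disjoint_insert_right] at hdisj
      obtain ⟨hiD, hDT⟩ := hdisj
      let Y : Ω → Fin L → Fin d → ℝ := fun ω j => if j ∈ T then U j ω else 0
      have hY : Measurable Y := by
        refine measurable_pi_lambda _ fun j => ?_
        by_cases hj : j ∈ T
        · simpa [Y, hj] using hU j
        · simp [Y, hj]
      have hYU : IndepFun Y (U i) Pr := by
        have h := hind.indepFun_finset T {i} (Finset.disjoint_singleton_right.2 hiT) hU
        have hext : Measurable fun (y : T → Fin d → ℝ) (j : Fin L) =>
            if hj : j ∈ T then y ⟨j, hj⟩ else 0 := by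
          refine measurable_pi_lambda _ fun j => ?_
          by_cases hj : j ∈ T
          · simpa [hj] using measurable_pi_apply (⟨j, hj⟩ : T)
          · simp [hj]
        have hval : Measurable fun z : ({i} : Finset (Fin L)) → Fin d → ℝ =>
            z ⟨i, Finset.mem_singleton_self i⟩ := measurable_pi_apply _
        exact h.comp hext hval
      have hvset : ∀ ω x, Set.EqOn (v (Function.update (Y ω) i x)) (v fun j => U j ω)
          ((D : Set (Fin L)) ∪ T) := by
        rintro ω x j (hj | hj)
        · simp [v, Finset.mem_coe.1 hj]
        · have hji : j ≠ i := fun h => hiT (h ▸ hj)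
          simp [v, hji, Y, Finset.mem_coe.1 hj]
      have hvi : ∀ y x, v (Function.update y i x) i = ψ x := fun y x => by simp [v, hiD]
      let A : Set ((Fin L → Fin d → ℝ) × (Fin d → ℝ)) :=
        {p | LinearIndepOn ℝ (v (Function.update p.1 i p.2)) (insert i ((D : Set (Fin L)) ∪ T))}
      have hA : MeasurableSet A := by
        have hcont : Continuous fun (p : (Fin L → Fin d → ℝ) × (Fin d → ℝ))
            (j : ↥(insert i ((D : Set (Fin L)) ∪ T))) => v (Function.update p.1 i p.2) j := by
          refine continuous_pi fun j => ?_
          by_cases hj : (j : Fin L) ∈ D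
          · simpa [v, hj] using continuous_const
          · simp only [v, hj, if_false]
            fun_prop
        exact (isOpen_setOfPred_linearIndependent.preimage hcont).measurableSet
      have hmem : ∀ᵐ ω ∂Pr, (Y ω, U i ω) ∈ A := by
        refine ae_mem_of_indepFun hYU hY (hU i) hA ?_
        filter_upwards [ih hDT] with ω hω
        have hV : Submodule.span ℝ ((v fun j => U j ω) '' ((D : Set (Fin L)) ∪ T)) ≠ ⊤ := by
          intro htop
          -- fewer than `L` vectors do not span
          have hi' : i ∉ D ∪ T := by simp [hiD, hiT]
          have hcard : (D ∪ T).card < L := by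
            simpa using Finset.card_lt_univ_of_notMem hi'
          have hle := finrank_span_finset_le_card (R := ℝ) ((D ∪ T).image (v fun j => U j ω))
          rw [Finset.coe_image, Finset.coe_union, Set.finrank, htop, finrank_top,
            Module.finrank_fin_fun] at hle
          exact absurd (hle.trans Finset.card_image_le) (not_le.2 hcard)
        filter_upwards [(hac i).ae_le (ae_notMem_of_span_range_eq_top ψ hψ hV)] with x hx
        refine LinearIndepOn.insert (hω.congr (hvset ω x).symm) ?_
        rwa [hvi, Set.EqOn.image_eq (hvset ω x)]
      filter_upwards [hmem] with ω hω
      have hunion : (D : Set (Fin L)) ∪ ↑(insert i T) = insert i ((D : Set (Fin L)) ∪ T) := by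
        rw [Finset.coe_insert, Set.union_insert]
      rw [hunion]
      refine LinearIndepOn.congr (v := v (Function.update (Y ω) i (U i ω))) hω ?_
      rintro j (rfl | hj)
      · simp [v, hiD]
      · exact hvset ω _ hj
  filter_upwards [key Dᶜ disjoint_compl_right] with ω hω
  rw [Finset.coe_compl, Set.union_compl_self, linearIndepOn_univ_iff] at hω
  exact hω

theorem linearIndepOn_single_edge {L : ℕ} (i : Fin L) {σ : Fin L → Fin L} {a b : Fin L}
    (hσ : Set.InjOn σ (Set.Iio i)) (hab : a ≠ b) (ha : ∀ j < i, σ j ≠ a) (hb : ∀ j < i, σ j ≠ b) :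
    LinearIndepOn ℝ (fun j => if j < i then (Pi.single (σ j) 1 : Fin L → ℝ)
      else Pi.single a 1 - Pi.single b 1) (Finset.Iic i : Set (Fin L)) := by
  -- the coordinates `σ j` and `a` are biorthogonal to this family
  refine LinearIndependent.of_pairwise_dual_eq_zero_one _
    (fun j => LinearMap.proj (if (j : Fin L) < i then σ j else a)) ?_ ?_
  · rintro ⟨j, hj⟩ ⟨k, hk⟩ hjk
    have hjk' : j ≠ k := fun h => hjk (Subtype.ext h)
    have hji : j ≤ i := Finset.mem_Iic.1 hj
    have hki : k ≤ i := Finset.mem_Iic.1 hk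
    by_cases h1 : j < i <;> by_cases h2 : k < i
    · have : σ j ≠ σ k := fun h => hjk' (hσ h1 h2 h)
      simp [h1, h2, this]
    · simp [h1, h2, ha j h1, hb j h1]
    · simp [h1, h2, (ha k h2).symm]
    · exact absurd ((hji.eq_of_not_lt h1).trans (hki.eq_of_not_lt h2).symm) hjk'
  · rintro ⟨j, hj⟩
    by_cases h1 : j < i
    · simp [h1]
    · simp [h1, hab]

/-- Independent uniform draws are almost surely in general position. -/
theorem ae_inGeneralPosition {Ω : Type*} [MeasurableSpace Ω] {Pr : Measure Ω}
    [IsProbabilityMeasure Pr] {d L : ℕ} {ψ : (Fin d → ℝ) →ᵃ[ℝ] (Fin L → ℝ)}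
    (hψ : Submodule.span ℝ (Set.range ψ) = ⊤) {U : Fin L → Ω → Fin d → ℝ}
    (hU : ∀ i, Measurable (U i)) (hind : iIndepFun U Pr) (hac : ∀ i, Pr.map (U i) ≪ volume) :
    ∀ᵐ ω ∂Pr, InGeneralPosition fun j => ψ (U j ω) := by
  have h1 : ∀ᵐ ω ∂Pr, LinearIndependent ℝ fun j => ψ (U j ω) := by
    simpa using ae_linearIndependent hψ hU hind hac ∅ (f := 0) (by simp)
  have h2 : ∀ᵐ ω ∂Pr, ∀ (i : Fin L) (σ : Fin L → Fin L) (a b : Fin L),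
      Set.InjOn σ (Set.Iio i) → a ≠ b → (∀ j < i, σ j ≠ a) → (∀ j < i, σ j ≠ b) →
      LinearIndependent ℝ fun j => if j < i then (Pi.single (σ j) 1 : Fin L → ℝ)
        else if j = i then Pi.single a 1 - Pi.single b 1 else ψ (U j ω) := by
    simp only [ae_all_iff]
    intro i σ a b hσ hab ha hb
    filter_upwards [ae_linearIndependent hψ hU hind hac (Finset.Iic i)
      (linearIndepOn_single_edge i hσ hab ha hb)] with ω hω
    convert hω using 2 with j
    rcases lt_trichotomy j i with h | rfl | h
    · simp [h, h.le]
    · simp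
    · simp [h.ne', not_lt.2 h.le, not_le.2 h]
  filter_upwards [h1, h2] with ω hω1 hω2
  exact ⟨hω1, hω2⟩

end Random

end PartialLabels

open PartialLabels in
theorem mainTheorem2 {X : Type*} [MeasurableSpace X] {Ω : Type*} [MeasurableSpace Ω]
    (Pr : MeasureTheory.Measure Ω) [MeasureTheory.IsProbabilityMeasure Pr]
    {L M : ℕ} (hL : 2 ≤ L)
    (P : Fin L → MeasureTheory.ProbabilityMeasure X)
    (mixing : Matrix (Fin M) (Fin L) ℝ)
    (hmixing : ∀ i, mixing i ∈ stdSimplex ℝ (Fin L))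
    (hP : PartialLabels.JointlyIrreducible P)
    (hrank : mixing.rank = L)
    (hS : Function.Injective (PartialLabels.partialLabelMatrix mixing).col)
    (Q : Fin L → Ω → MeasureTheory.SignedMeasure X)
    (hQ : PartialLabels.IndepUniformOn Pr
      (convexHull ℝ (Set.range (PartialLabels.contaminated mixing P))) Q) :
    ∀ᵐ ω ∂Pr, PartialLabels.PartialLabelReturns (PartialLabels.partialLabelMatrix mixing)
      (PartialLabels.contaminated mixing P) (fun i => Q i ω)
      (fun i => PartialLabels.toSM (P i)) := by
  obtain ⟨d, φ, U, -, hrange, hU, hind, hunif, hQU⟩ := hQ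
  have hK : convexHull ℝ (Set.range (contaminated mixing P)) =
      mix P '' convexHull ℝ (Set.range mixing.row) := by
    rw [(mix P).image_convexHull, ← Set.range_comp]
    exact congrArg _ (congrArg Set.range (funext (contaminated_eq_mix mixing P)))
  -- the affine chart `φ` read in the coordinates of `mix`
  obtain ⟨T, hT⟩ := (mix P).exists_leftInverse_of_injective
    (LinearMap.ker_eq_bot.2 hP.mix_injective)
  have hT' : ∀ c, T (mix P c) = c := fun c => LinearMap.congr_fun hT c
  let ψ : (Fin d → ℝ) →ᵃ[ℝ] (Fin L → ℝ) := T.toAffineMap.comp φ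
  have hφψ : ∀ u, φ u = mix P (ψ u) := fun u => by
    have hle : affineSpan ℝ (convexHull ℝ (Set.range (contaminated mixing P))) ≤
        (LinearMap.range (mix P)).toAffineSubspace := by
      rw [affineSpan_le, hK]
      rintro _ ⟨c, -, rfl⟩
      exact ⟨c, rfl⟩
    have hu : φ u ∈ (affineSpan ℝ (convexHull ℝ (Set.range (contaminated mixing P))) :
      Set (SignedMeasure X)) := hrange ▸ Set.mem_range_self u
    obtain ⟨c, hc⟩ := hle hu
    change φ u = mix P (T (φ u))
    rw [← hc, hT']
  have hψ : Submodule.span ℝ (Set.range ψ) = ⊤ := by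
    have hrows : Submodule.span ℝ (Set.range mixing.row) = ⊤ := by
      refine Submodule.eq_top_of_finrank_eq ?_
      rw [← mixing.rank_eq_finrank_span_row, hrank, Module.finrank_fin_fun]
    rw [eq_top_iff, ← hrows, Submodule.span_le]
    rintro _ ⟨i, rfl⟩
    have hi : contaminated mixing P i ∈ Set.range φ := by
      rw [hrange]
      exact subset_affineSpan ℝ _ (subset_convexHull ℝ _ ⟨i, rfl⟩)
    obtain ⟨u, hu⟩ := hi
    refine Submodule.subset_span ⟨u, hP.mix_injective ?_⟩
    rw [← hφψ, hu, contaminated_eq_mix]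
    rfl
  have hpre : φ ⁻¹' convexHull ℝ (Set.range (contaminated mixing P)) =
      ψ ⁻¹' convexHull ℝ (Set.range mixing.row) := by
    ext u
    rw [Set.mem_preimage, hφψ, hK, hP.mix_injective.mem_set_image, Set.mem_preimage]
  have hmeas : MeasurableSet (ψ ⁻¹' convexHull ℝ (Set.range mixing.row)) :=
    ((Set.finite_range mixing.row).isCompact_convexHull (𝕜 := ℝ)).isClosed.measurableSet.preimage
      ψ.continuous_of_finiteDimensional.measurable
  have hmem : ∀ i, ∀ᵐ ω ∂Pr, ψ (U i ω) ∈ stdSimplex ℝ (Fin L) := fun i => by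
    have h := hunif i
    rw [pdf.IsUniform, hpre] at h
    have hae : ∀ᵐ u ∂Pr.map (U i), u ∈ ψ ⁻¹' convexHull ℝ (Set.range mixing.row) := by
      rw [h]
      exact ae_cond_mem hmeas
    filter_upwards [ae_of_ae_map (hU i).aemeasurable hae] with ω hω
    exact convexHull_min (by rintro _ ⟨i, rfl⟩; exact hmixing i) (convex_stdSimplex ℝ _) hω
  filter_upwards [ae_all_iff.2 hQU, ae_all_iff.2 hmem,
    ae_inGeneralPosition hψ hU hind fun i => (hunif i).absolutelyContinuous] with ω hQω hω hgen
  have hfun : (fun i => Q i ω) = fun i => mix P (ψ (U i ω)) := funext fun i => by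
    rw [hQω, hφψ]
  rw [hfun]
  exact partialLabelReturns_of_inGeneralPosition hP hL hmixing hS hω hgen
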